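/- Let $K$ be a number of users, where user $k$ has $N_k$ receive antennas and $d_k$ data streams, let $N_T$ be the number of transmit antennas and $N_I$ the number of RIS elements, and let $Z_0>0$. A channel realization consists of complex matrices $H_{d,k}\in\mathbb C^{N_k\times N_T}$, $H_{r,k}\in\mathbb C^{N_k\times N_I}$ ($1\le k\le K$) and $G\in\mathbb C^{N_I\times N_T}$. For a real symmetric matrix $B\in\mathbb R^{N_I\times N_I}$ put $\Theta(B)=(I+\mathrm i Z_0B)^{-1}(I-\mathrm i Z_0B)$, and let $H_{\mathrm{eff}}(\Theta)\in\mathbb C^{(\sum_kN_k)\times N_T}$ be the matrix obtained by stacking the blocks $H_{d,k}+H_{r,k}\Theta G$, $k=1,\dots,K$. Let $\mathcal W\subseteq\mathbb C^{N_T\times\sum_kd_k}$ be any set and let $F(W,H)\in[-\infty,\infty]$ be any utility function of $W\in\mathbb C^{N_T\times\sum_kd_k}$ and $H\in\mathbb C^{(\sum_kN_k)\times N_T}$ such that $H\mapsto\sup_{W\in\mathcal W}F(W,H)$ is lower semicontinuous (for instance, $F(W,\cdot)$ is continuous for every $W\in\mathcal W$). For a simple graph $\mathcal G$ on the vertices $\{1,\dots,N_I\}$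 let $$P_{\mathcal G}=\sup\bigl\{F(W,H_{\mathrm{eff}}(\Theta(B))) : W\in\mathcal W,\ B=B^T\in\mathbb R^{N_I\times N_I},\ B_{n,m}=0\text{ for all } n\ne m\text{ that are not adjacent in }\mathcal G\bigr\},$$ and let $P_{\mathrm{fully}}$ be the same supremum over all real symmetric $B$ (fully-connected RIS). Let $D=\min\{\sum_kN_k,N_T\}$ and $L=\min\{D,N_I/2\}$. Suppose that the adjacency matrix of $\mathcal G$ can be written as $A_{\mathcal G}=P\bar AP^T$ with a permutation matrix $P$ and a matrix $\bar A$ such that $$\sum_{m=n+1}^{N_I}\bar A(n,m)=\min\{2L-1,\,N_I-n\},\qquad 1\le n\le N_I-1.$$ Then $P_{\mathcal G}=P_{\mathrm{fully}}$ for almost all channel realizations, that is, for all $(H_{d,k})_k,(H_{r,k})_k,G$ outside a set of Lebesgue measure zero. -/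

import Mathlib

namespace BDRIS

noncomputable section

/-- A channel realization of a system with `K` users, `N k` receive antennas at user `k`, `NT`
transmit antennas and `NI` RIS elements. It consists of the transmitter-to-user channels
`H_{d,k}` (size `N k × NT`), the RIS-to-user channels `H_{r,k}` (size `N k × NI`) and the
transmitter-to-RIS channel `G` (size `NI × NT`). It is written as a product of function spaces
so that `volume` is the Lebesgue measure on the (complex) entries. -/
abbrev Channel (K : ℕ) (N : Fin K → ℕ) (NI NT : ℕ) : Type :=
  ((k : Fin K) → Fin (N k) → Fin NT → ℂ) ×
    ((k : Fin K) → Fin (N k) → Fin NI → ℂ) × (Fin NI → Fin NT → ℂ)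

variable {K : ℕ} {N : Fin K → ℕ} {NI NT : ℕ}

/-- The direct channel `H_{d,k}`. -/
def Channel.direct (h : Channel K N NI NT) (k : Fin K) : Matrix (Fin (N k)) (Fin NT) ℂ :=
  Matrix.of (h.1 k)

/-- The channel `H_{r,k}` from the RIS to user `k`. -/
def Channel.reflect (h : Channel K N NI NT) (k : Fin K) : Matrix (Fin (N k)) (Fin NI) ℂ :=
  Matrix.of (h.2.1 k)

/-- The channel `G` from the transmitter to the RIS. -/
def Channel.incident (h : Channel K N NI NT) : Matrix (Fin NI) (Fin NT) ℂ :=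
  Matrix.of h.2.2

/-- The scattering matrix `Θ = (I + i Z₀ B)⁻¹ (I - i Z₀ B)` of a susceptance matrix `B`.
(For `B` real symmetric, `I + i Z₀ B` is invertible, since the eigenvalues of `B` are real.) -/
def scattering (Z₀ : ℝ) (B : Matrix (Fin NI) (Fin NI) ℝ) : Matrix (Fin NI) (Fin NI) ℂ :=
  (1 + (Complex.I * (Z₀ : ℂ)) • B.map Complex.ofReal)⁻¹ *
    (1 - (Complex.I * (Z₀ : ℂ)) • B.map Complex.ofReal)

/-- The effective channel `H_{eff,k}(Θ) = H_{d,k} + H_{r,k} Θ G` of user `k`. -/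
def userEffChannel (h : Channel K N NI NT) (Θ : Matrix (Fin NI) (Fin NI) ℂ) (k : Fin K) :
    Matrix (Fin (N k)) (Fin NT) ℂ :=
  h.direct k + h.reflect k * Θ * h.incident

/-- The effective channel `H_eff(Θ)` of all users, of size `(∑ k, N k) × NT`: the matrices
`H_{eff,k}(Θ)` stacked on top of each other, with rows indexed by pairs (user, antenna). -/
def effChannel (h : Channel K N NI NT) (Θ : Matrix (Fin NI) (Fin NI) ℂ) :
    Matrix ((k : Fin K) × Fin (N k)) (Fin NT) ℂ :=
  Matrix.of fun r j => userEffChannel h Θ r.1 r.2 j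

/-- The set `𝓑_G` of matrices whose off-diagonal entries vanish outside the edges of `G`. -/
def graphSet (G : SimpleGraph (Fin NI)) : Set (Matrix (Fin NI) (Fin NI) ℝ) :=
  {B | ∀ n m, n ≠ m → ¬ G.Adj n m → B n m = 0}

/-- The optimal value (supremum in `[-∞, ∞]`) of the utility maximization problem over the
beamforming matrix `W ∈ 𝒲` (columns indexed by pairs (user, stream)), the scattering matrix `Θ`
and the symmetric susceptance matrix `B ∈ 𝓑`. -/
def optValue {d : Fin K → ℕ} (Z₀ : ℝ)
    (F : Matrix (Fin NT) ((k : Fin K) × Fin (d k)) ℂ →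
      Matrix ((k : Fin K) × Fin (N k)) (Fin NT) ℂ → EReal)
    (𝒲 : Set (Matrix (Fin NT) ((k : Fin K) × Fin (d k)) ℂ))
    (𝓑 : Set (Matrix (Fin NI) (Fin NI) ℝ)) (h : Channel K N NI NT) : EReal :=
  sSup {y | ∃ (W : Matrix (Fin NT) ((k : Fin K) × Fin (d k)) ℂ)
      (Θ : Matrix (Fin NI) (Fin NI) ℂ) (B : Matrix (Fin NI) (Fin NI) ℝ),
      Θ = scattering Z₀ B ∧ B = B.transpose ∧ B ∈ 𝓑 ∧ W ∈ 𝒲 ∧ y = F W (effChannel h Θ)}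

/-- The optimal value `P_G` for the BD-RIS architecture given by the graph `G`. -/
def graphValue {d : Fin K → ℕ} (Z₀ : ℝ)
    (F : Matrix (Fin NT) ((k : Fin K) × Fin (d k)) ℂ →
      Matrix ((k : Fin K) × Fin (N k)) (Fin NT) ℂ → EReal)
    (𝒲 : Set (Matrix (Fin NT) ((k : Fin K) × Fin (d k)) ℂ))
    (G : SimpleGraph (Fin NI)) (h : Channel K N NI NT) : EReal :=
  optValue Z₀ F 𝒲 (graphSet G) h

/-- The optimal value `P_fully` for a fully-connected RIS (no constraint on the support of `B`). -/
def fullValue {d : Fin K → ℕ} (Z₀ : ℝ)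
    (F : Matrix (Fin NT) ((k : Fin K) × Fin (d k)) ℂ →
      Matrix ((k : Fin K) × Fin (N k)) (Fin NT) ℂ → EReal)
    (𝒲 : Set (Matrix (Fin NT) ((k : Fin K) × Fin (d k)) ℂ))
    (h : Channel K N NI NT) : EReal :=
  optValue Z₀ F 𝒲 Set.univ h

/-- `D = min {∑ k, N k, NT}`. -/
def dof (N : Fin K → ℕ) (NT : ℕ) : ℕ := min (∑ k, N k) NT

/-- `L = min {D, NI / 2}`, a real number (a half-integer is possible). -/
def bigL (N : Fin K → ℕ) (NI NT : ℕ) : ℝ := min (dof N NT : ℝ) ((NI : ℝ) / 2)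

/-- The graph condition: `A_G = P Ā Pᵀ` for a permutation matrix `P` and a matrix `Ā` whose `n`-th
row, for `1 ≤ n ≤ NI - 1`, has sum `min {2 L - 1, NI - n}` to the right of the diagonal. Rows are
numbered from `0` in `Fin NI`, so that `n : Fin NI` stands for row number `n + 1`. -/
def GraphCondition (L : ℝ) (G : SimpleGraph (Fin NI)) [DecidableRel G.Adj] : Prop :=
  ∃ (σ : Equiv.Perm (Fin NI)) (Abar : Matrix (Fin NI) (Fin NI) ℝ),
    G.adjMatrix ℝ = σ.permMatrix ℝ * Abar * (σ.permMatrix ℝ).transpose ∧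
    ∀ n : Fin NI, (n : ℕ) + 1 ≤ NI - 1 →
      ∑ m ∈ Finset.Ioi n, Abar n m = min (2 * L - 1) ((NI : ℝ) - ((n : ℕ) + 1 : ℝ))

end

end BDRIS

namespace BDRIS

/-! Put `V = (I + i Z₀ B)⁻¹ X`. If `B' V = B V`, then `(I + i Z₀ B') V = X`, so `B` and `B'` give
scattering matrices with the same product with `X`. The effective channel needs only such a product:
with `X = G`, or, because scattering matrices are symmetric, with `X` the stacked `H_{r,k}`
transposed. Choosing the one with fewer columns leaves `D` complex, hence `2D` real, equations per
row of `B'`.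

These are solved by elimination along the vertex order (`exists_isSymm_supported_mul_eq`). A
diagonal entry and `2D - 1` later neighbours give `2D` unknowns per row, until the remaining block
is full and its solution is automatically symmetric. This needs nonzero maximal minors of `[Re V, Im
V]`.

Those minors may vanish for particular `B`, so `B` is replaced by `t B`: the minors are analytic in
`t`, and at `t = 0` they are those of `X`, nonzero for almost every channel
(`eventually_minors_ne_zero`, `ae_minors_ne_zero`). The exceptional null set is thus independent of
`B`, and lower semicontinuity allows `t → 1` (`graphValue_eq_fullValue`). -/

/-! ### Symmetric matrix equations with prescribed support -/

open Matrix Finset in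
/-- A row vector supported on a set of `card κ` rows of `R` realises a prescribed product. -/
theorem exists_vecMul_eq_of_supported {κ α : Type*} [Fintype κ] [DecidableEq κ] [Fintype α]
    [DecidableEq α] (R : Matrix α κ ℝ)
    (hR : ∀ e : κ → α, Function.Injective e → (R.submatrix e id).det ≠ 0)
    (s : Finset α) (hs : s.card = Fintype.card κ) (c : κ → ℝ) :
    ∃ b : α → ℝ, (∀ i, i ∉ s → b i = 0) ∧ b ᵥ* R = c := by
  have e : κ ≃ s := Fintype.equivOfCardEq (by simp [hs])
  set Q := R.submatrix (fun x => (e x : α)) id with hQ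
  have hdet : IsUnit Q.det :=
    (hR _ (Subtype.val_injective.comp e.injective)).isUnit
  refine ⟨fun i => if h : i ∈ s then (c ᵥ* Q⁻¹) (e.symm ⟨i, h⟩) else 0,
    fun i hi => by simp [hi], ?_⟩
  have h1 : (c ᵥ* Q⁻¹) ᵥ* Q = c := by
    rw [vecMul_vecMul, nonsing_inv_mul _ hdet, vecMul_one]
  conv_rhs => rw [← h1]
  ext y
  simp only [vecMul, dotProduct]
  rw [← Finset.sum_subset (Finset.subset_univ s) (by intro x _ hx; simp [hx]),
    ← Finset.sum_coe_sort s, ← e.sum_comp]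
  exact Finset.sum_congr rfl fun x _ => by simp [hQ]

open Matrix Finset in
/-- If `R` has nonvanishing maximal minors and every vertex of a graph on `Fin n` has sufficiently
many later neighbours, then `B * R = C` has a symmetric solution supported on the graph as soon as
it has any symmetric solution. -/
theorem exists_isSymm_supported_mul_eq {κ : Type*} [Fintype κ] [DecidableEq κ] [Nonempty κ]
    (k : ℕ) : ∀ (n : ℕ), n = k + Fintype.card κ → ∀ (R C : Matrix (Fin n) κ ℝ),
    (∀ e : κ → Fin n, Function.Injective e → (R.submatrix e id).det ≠ 0) → (Rᵀ * C).IsSymm →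
    ∀ A : Fin n → Fin n → Prop, (∀ i j, A i j → A j i) →
    (∀ i, ∃ s : Finset (Fin n), (∀ j ∈ s, i < j ∧ A i j) ∧
      s.card = min (Fintype.card κ - 1) (n - 1 - i)) →
    ∃ B : Matrix (Fin n) (Fin n) ℝ, B.IsSymm ∧ (∀ i j, i ≠ j → ¬ A i j → B i j = 0) ∧
      B * R = C := by
  have hκ : 0 < Fintype.card κ := Fintype.card_pos
  induction k with
  | zero =>
    intro n hn R C hR hRC A hA hs
    have e : κ ≃ Fin n := Fintype.equivOfCardEq (by simp [hn])
    have hdet : IsUnit (R.submatrix e id).det := (hR e e.injective).isUnit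
    obtain ⟨Q, hQ⟩ : ∃ Q : Matrix κ (Fin n) ℝ, Q * R = 1 ∧ R * Q = 1 := by
      refine ⟨(R.submatrix e id)⁻¹.submatrix id e.symm, ?_, ?_⟩
      · have : R = (R.submatrix e id).submatrix e.symm id := by ext; simp
        conv_lhs => rw [this]
        rw [submatrix_mul_equiv, submatrix_submatrix]
        simp [nonsing_inv_mul _ hdet]
      · have : R = (R.submatrix e id).submatrix e.symm id := by ext; simp
        conv_lhs => rw [this]
        rw [← submatrix_mul _ _ e.symm id e.symm Function.bijective_id]
        simp [mul_nonsing_inv _ hdet]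
    refine ⟨C * Q, ?_, ?_, by rw [Matrix.mul_assoc, hQ.1, Matrix.mul_one]⟩
    -- The unique solution `C R⁻¹` is congruent to the symmetric matrix `Rᵀ C`.
    · have h1 : C * Q = Qᵀ * (Rᵀ * C) * Q := by
        rw [← Matrix.mul_assoc Qᵀ, ← transpose_mul, hQ.2]; simp
      rw [h1]
      unfold IsSymm at *
      rw [transpose_mul, transpose_mul, hRC, transpose_transpose, ← Matrix.mul_assoc]
    -- Here `n = card κ`, so the minimum is `n - 1 - i`: every later vertex is a neighbour.
    · have key : ∀ i j : Fin n, i < j → A i j := by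
        intro i j hij
        obtain ⟨s, hs1, hs2⟩ := hs i
        have : s = Ioi i := by
          apply Finset.eq_of_subset_of_card_le
          · intro x hx; simpa using (hs1 x hx).1
          · rw [hs2, Fin.card_Ioi]; omega
        exact (hs1 j (by rw [this]; simpa using hij)).2
      intro i j hij hn
      rcases lt_or_gt_of_ne hij with h | h
      · exact absurd (key _ _ h) hn
      · exact absurd (hA _ _ (key _ _ h)) hn
  | succ k ih =>
    intro n hn R C hR hRC A hA hs
    obtain ⟨n, rfl⟩ : ∃ m, n = m + 1 := ⟨k + Fintype.card κ, by omega⟩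
    obtain ⟨s, hs1, hs2⟩ := hs 0
    have h0s : (0 : Fin (n + 1)) ∉ s := fun h => lt_irrefl _ (hs1 0 h).1
    -- `b` becomes row 0 and, by symmetry, column 0 of `B`; `C'` below is what column 0 leaves for
    -- the other rows.
    obtain ⟨b, hb, hbR⟩ := exists_vecMul_eq_of_supported R hR (insert 0 s)
      (by rw [card_insert_of_notMem h0s, hs2]; simp; omega) (C 0)
    set R' : Matrix (Fin n) κ ℝ := of fun i x => R i.succ x with hR'
    set C' : Matrix (Fin n) κ ℝ := of fun i x => C i.succ x - b i.succ * R 0 x with hC'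
    have hC0 : ∀ x, C 0 x = b 0 * R 0 x + ∑ i : Fin n, b i.succ * R i.succ x := by
      intro x
      rw [← hbR]
      simp [vecMul, dotProduct, Fin.sum_univ_succ]
    -- With `r` row 0 of `R` and `w` the sum of `b i.succ` times row `i.succ`, the difference `Rᵀ C
    -- - R'ᵀ C'` is `b 0 • r rᵀ + r wᵀ + w rᵀ`, which is symmetric.
    have hsymm : (R'ᵀ * C').IsSymm := by
      apply IsSymm.ext
      intro x y
      have h := hRC.apply x y
      simp only [mul_apply, transpose_apply, Fin.sum_univ_succ, hC0] at h
      simp only [mul_apply, transpose_apply, hR', hC', of_apply, mul_sub, sum_sub_distrib]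
      have h1 : ∀ u v, ∑ i : Fin n, R i.succ u * (b i.succ * R 0 v) =
          R 0 v * ∑ i : Fin n, b i.succ * R i.succ u := by
        intro u v
        rw [mul_sum]
        exact sum_congr rfl fun _ _ => by ring
      rw [h1, h1]
      linarith
    have hcard : ∀ i : Fin n, ∃ s : Finset (Fin n), (∀ j ∈ s, i < j ∧ A i.succ j.succ) ∧
        s.card = min (Fintype.card κ - 1) (n - 1 - i) := by
      intro i
      obtain ⟨s, hs1, hs2⟩ := hs i.succ
      have hpos : ∀ j ∈ s, j ≠ 0 := fun j hj h => by
        have := (hs1 j hj).1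
        simp [h] at this
      refine ⟨s.preimage Fin.succ (Fin.succ_injective n).injOn, ?_, ?_⟩
      · intro j hj
        have := hs1 _ (mem_preimage.1 hj)
        exact ⟨by simpa using this.1, this.2⟩
      · rw [card_preimage, filter_true_of_mem, hs2]
        · simp only [Fin.val_succ]; omega
        · intro j hj
          exact ⟨j.pred (hpos j hj), by simp⟩
    obtain ⟨B, hB1, hB2, hB3⟩ := ih n (by omega) R' C'
      (fun e he => hR (fun x => (e x).succ) ((Fin.succ_injective n).comp he)) hsymm
      (fun i j => A i.succ j.succ) (fun i j => hA _ _) hcard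
    refine ⟨of fun i j => Fin.cases (b j) (fun i' => Fin.cases (b i'.succ) (fun j' => B i' j') j) i,
      ?_, ?_, ?_⟩
    · ext i j
      refine Fin.cases ?_ (fun i => ?_) i <;> refine Fin.cases ?_ (fun j => ?_) j
      · simp
      · simp
      · simp
      · simpa using hB1.apply i j
    · intro i j
      have hb' : ∀ j : Fin n, ¬ A 0 j.succ → b j.succ = 0 := by
        intro j h
        apply hb
        rw [mem_insert, not_or]
        exact ⟨Fin.succ_ne_zero j, fun h' => h (hs1 _ h').2⟩
      refine Fin.cases ?_ (fun i => ?_) i <;> refine Fin.cases ?_ (fun j => ?_) j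
      · simp
      · intro _ h; simpa using hb' j h
      · intro _ h; simpa using hb' i fun h' => h (hA _ _ h')
      · intro hij h
        simpa using hB2 i j (fun h' => hij (by rw [h'])) h
    · ext i x
      refine Fin.cases ?_ (fun i => ?_) i
      · simp [mul_apply, Fin.sum_univ_succ, hC0]
      · have := congrFun (congrFun hB3 i) x
        simp only [mul_apply, hR', hC', of_apply] at this
        simp [mul_apply, Fin.sum_univ_succ, this]


/-! ### Nonvanishing and analyticity of determinants -/

open Matrix MeasureTheory in
/-- A real-linear family of square matrices that contains the identity is almost everywhere
nonsingular. -/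
theorem ae_det_linearMap_ne_zero {E κ : Type*} [Fintype κ] [DecidableEq κ]
    [NormedAddCommGroup E] [NormedSpace ℝ E] [MeasurableSpace E] [BorelSpace E]
    [FiniteDimensional ℝ E] (μ : Measure E) [μ.IsAddHaarMeasure]
    (φ : E →ₗ[ℝ] Matrix κ κ ℝ) (v : E) (hv : φ v = 1) : ∀ᵐ x ∂μ, (φ x).det ≠ 0 := by
  have hφ : Continuous φ := φ.continuous_of_finiteDimensional
  have hs : MeasurableSet {x : E | (φ x).det ≠ 0} :=
    (isOpen_ne.preimage hφ.matrix_det).measurableSet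
  have : ProperSpace E := FiniteDimensional.proper_real E
  -- On each line `y + t v` the determinant is the characteristic polynomial of `-φ y` at `t`, with
  -- finitely many zeros.
  refine ae_mem_of_ae_add_linearMap_mem (LinearMap.toSpanSingleton ℝ E v) volume μ hs fun y => ?_
  have hfin : {t : ℝ | (-φ y).charpoly.IsRoot t}.Finite :=
    Polynomial.finite_setOfPred_isRoot (charpoly_monic _).ne_zero
  filter_upwards [hfin.countable.ae_notMem volume] with t ht h0
  refine ht ?_
  simp only [Polynomial.IsRoot, eval_charpoly]
  rw [← h0]
  congr 1
  rw [map_add, LinearMap.toSpanSingleton_apply, map_smul, hv, scalar_apply, smul_one_eq_diagonal]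
  abel

open Matrix in
theorem analyticAt_matrix_det {𝕜 A κ : Type*} [NontriviallyNormedField 𝕜] [NormedCommRing A]
    [NormedAlgebra 𝕜 A] [Fintype κ] [DecidableEq κ] {M : 𝕜 → Matrix κ κ A} {t : 𝕜}
    (h : ∀ i j, AnalyticAt 𝕜 (fun s => M s i j) t) : AnalyticAt 𝕜 (fun s => (M s).det) t := by
  simp only [det_apply']
  refine Finset.analyticAt_fun_sum _ fun σ _ => analyticAt_const.mul ?_
  exact Finset.analyticAt_fun_prod _ fun i _ => h _ _

open Matrix in
theorem analyticAt_matrix_inv {𝕜 A κ : Type*} [NontriviallyNormedField 𝕜] [NormedField A]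
    [NormedAlgebra 𝕜 A] [Fintype κ] [DecidableEq κ] {M : 𝕜 → Matrix κ κ A} {t : 𝕜}
    (h : ∀ i j, AnalyticAt 𝕜 (fun s => M s i j) t) (h0 : (M t).det ≠ 0) (i j : κ) :
    AnalyticAt 𝕜 (fun s => (M s)⁻¹ i j) t := by
  simp only [inv_def, Matrix.smul_apply, smul_eq_mul, Ring.inverse_eq_inv', adjugate_apply]
  refine ((analyticAt_matrix_det h).fun_inv h0).mul (analyticAt_matrix_det fun a b => ?_)
  simp only [updateRow_apply]
  split_ifs
  · exact analyticAt_const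
  · exact h a b

/-! ### Scattering matrices and their dependence on the susceptance -/

/-- The matrix `I + i Z₀ B`, whose inverse enters the scattering matrix. -/
noncomputable def denom {n : ℕ} (Z₀ : ℝ) (B : Matrix (Fin n) (Fin n) ℝ) :
    Matrix (Fin n) (Fin n) ℂ :=
  1 + (Complex.I * (Z₀ : ℂ)) • B.map Complex.ofReal

-- `S = Z₀ B` is Hermitian, so `(1 - iS)(1 + iS) = 1 + Sᴴ S` is positive definite.
open Matrix ComplexOrder in
theorem det_denom_ne_zero {n : ℕ} (Z₀ : ℝ) {B : Matrix (Fin n) (Fin n) ℝ} (hB : B.IsSymm) :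
    (denom Z₀ B).det ≠ 0 := by
  set S : Matrix (Fin n) (Fin n) ℂ := (Z₀ : ℂ) • B.map Complex.ofReal with hS
  have hSh : Sᴴ = S := by
    ext i j
    simp [hS, hB.apply i j]
  have hpd : (1 + Sᴴ * S).PosDef := PosDef.one.add_posSemidef (posSemidef_conjTranspose_mul_self S)
  have hfac : (1 - Complex.I • S) * denom Z₀ B = 1 + Sᴴ * S := by
    rw [hSh, denom, mul_smul, ← hS]
    simp only [Matrix.mul_add, Matrix.sub_mul, Matrix.mul_one, Matrix.one_mul, Matrix.smul_mul,
      Matrix.mul_smul, smul_sub, smul_smul, Complex.I_mul_I, neg_smul, one_smul]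
    abel
  intro h0
  have := hpd.det_pos.ne'
  rw [← hfac, det_mul, h0, mul_zero] at this
  exact this rfl

open Matrix in
theorem scattering_eq_mul_inv {n : ℕ} (Z₀ : ℝ) {B : Matrix (Fin n) (Fin n) ℝ} (hB : B.IsSymm) :
    scattering Z₀ B =
      (1 - (Complex.I * (Z₀ : ℂ)) • B.map Complex.ofReal) * (denom Z₀ B)⁻¹ := by
  have hu := (det_denom_ne_zero Z₀ hB).isUnit
  have hc : denom Z₀ B * (1 - (Complex.I * (Z₀ : ℂ)) • B.map Complex.ofReal) =
      (1 - (Complex.I * (Z₀ : ℂ)) • B.map Complex.ofReal) * denom Z₀ B := by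
    simp only [denom, Matrix.mul_sub, Matrix.sub_mul, Matrix.mul_add, Matrix.add_mul,
      Matrix.mul_one, Matrix.one_mul, Matrix.smul_mul, Matrix.mul_smul, smul_add, smul_sub]
    abel
  calc scattering Z₀ B = (denom Z₀ B)⁻¹ *
        ((1 - (Complex.I * (Z₀ : ℂ)) • B.map Complex.ofReal) * denom Z₀ B) * (denom Z₀ B)⁻¹ := by
          rw [Matrix.mul_assoc, Matrix.mul_assoc, mul_nonsing_inv _ hu, Matrix.mul_one]; rfl
    _ = _ := by rw [← hc, ← Matrix.mul_assoc, nonsing_inv_mul _ hu, Matrix.one_mul]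

open Matrix in
theorem scattering_isSymm {n : ℕ} (Z₀ : ℝ) {B : Matrix (Fin n) (Fin n) ℝ} (hB : B.IsSymm) :
    (scattering Z₀ B).IsSymm := by
  have hBt : (B.map Complex.ofReal)ᵀ = B.map Complex.ofReal := by rw [← transpose_map, hB]
  rw [IsSymm]
  conv_rhs => rw [scattering_eq_mul_inv Z₀ hB]
  rw [scattering, transpose_mul, transpose_nonsing_inv, transpose_sub, transpose_add,
    transpose_smul, hBt, transpose_one, denom]

/-- The real and the imaginary part of a complex matrix, side by side. -/
def realParts {n ι : Type*} (X : Matrix n ι ℂ) : Matrix n (ι ⊕ ι) ℝ :=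
  Matrix.fromCols (X.map Complex.re) (X.map Complex.im)

-- As `B` is real, one complex column amounts to two real ones; this is the source of the factor 2
-- in `2L - 1`.
open Matrix in
theorem realParts_mul {n ι : Type*} [Fintype n] (B : Matrix n n ℝ) (X : Matrix n ι ℂ) :
    realParts (B.map Complex.ofReal * X) = B * realParts X := by
  ext i (j | j) <;> simp [realParts, mul_apply]

theorem realParts_injective {n ι : Type*} :
    Function.Injective (realParts : Matrix n ι ℂ → Matrix n (ι ⊕ ι) ℝ) := by
  intro X Y h
  ext i j
  exact Complex.ext (by simpa [realParts] using congrFun (congrFun h i) (Sum.inl j))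
    (by simpa [realParts] using congrFun (congrFun h i) (Sum.inr j))

open Matrix in
/-- Two scattering matrices agree on `X` if the susceptance matrices agree on `(I + i Z₀ B)⁻¹ X`. -/
theorem scattering_mul_eq {n : ℕ} {ι : Type*} (Z₀ : ℝ) {B B' : Matrix (Fin n) (Fin n) ℝ}
    (hB : B.IsSymm) (hB' : B'.IsSymm) (X : Matrix (Fin n) ι ℂ)
    (h : B' * realParts ((denom Z₀ B)⁻¹ * X) = B * realParts ((denom Z₀ B)⁻¹ * X)) :
    scattering Z₀ B' * X = scattering Z₀ B * X := by
  have hu := (det_denom_ne_zero Z₀ hB).isUnit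
  have hu' := (det_denom_ne_zero Z₀ hB').isUnit
  rw [← realParts_mul, ← realParts_mul] at h
  replace h := realParts_injective h
  rw [scattering_eq_mul_inv Z₀ hB, scattering_eq_mul_inv Z₀ hB', Matrix.mul_assoc,
    Matrix.mul_assoc]
  set V := (denom Z₀ B)⁻¹ * X with hV
  have h1 : denom Z₀ B' * V = X := by
    have : denom Z₀ B * V = X := by rw [hV, ← Matrix.mul_assoc, mul_nonsing_inv _ hu, Matrix.one_mul]
    rw [← this, denom, denom, Matrix.add_mul, Matrix.add_mul, smul_mul, smul_mul, h]
  have h2 : (denom Z₀ B')⁻¹ * X = V := by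
    rw [← h1, ← Matrix.mul_assoc, nonsing_inv_mul _ hu', Matrix.one_mul]
  rw [h2, Matrix.sub_mul, Matrix.sub_mul, smul_mul, smul_mul, h]

open Matrix Filter Topology in
/-- Generic maximal minors of `X` stay generic for `(I + i Z₀ t B)⁻¹ X` and `t` close to `1`. -/
theorem eventually_minors_ne_zero {n : ℕ} {ι : Type*} [Fintype ι] [DecidableEq ι] (Z₀ : ℝ)
    {B : Matrix (Fin n) (Fin n) ℝ} (hB : B.IsSymm) (X : Matrix (Fin n) ι ℂ)
    (hX : ∀ e : ι ⊕ ι → Fin n, Function.Injective e → ((realParts X).submatrix e id).det ≠ 0) :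
    ∀ᶠ t : ℝ in 𝓝[≠] 1, ∀ e : ι ⊕ ι → Fin n, Function.Injective e →
      ((realParts ((denom Z₀ (t • B))⁻¹ * X)).submatrix e id).det ≠ 0 := by
  rw [eventually_all]
  intro e
  rw [eventually_imp_distrib_left]
  intro he
  set f : ℝ → ℝ := fun t => ((realParts ((denom Z₀ (t • B))⁻¹ * X)).submatrix e id).det with hf
  have hV : ∀ (t : ℝ) i j, AnalyticAt ℝ (fun t : ℝ => ((denom Z₀ (t • B))⁻¹ * X) i j) t := by
    intro t i j
    simp only [mul_apply]
    refine Finset.analyticAt_fun_sum _ fun k _ => AnalyticAt.mul ?_ analyticAt_const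
    refine analyticAt_matrix_inv (M := fun t : ℝ => denom Z₀ (t • B)) (fun a b => ?_)
      (det_denom_ne_zero Z₀ (hB.smul t)) i k
    simp only [denom, Matrix.add_apply, Matrix.smul_apply, map_apply, smul_eq_mul, Complex.ofReal_mul]
    exact analyticAt_const.add (analyticAt_const.mul
      ((Complex.ofRealCLM.analyticAt t).mul analyticAt_const))
  have hfa : AnalyticOnNhd ℝ f Set.univ := by
    intro t _
    refine analyticAt_matrix_det fun a b => ?_
    rcases b with b | b
    · exact (Complex.reCLM.analyticAt _).comp (hV t (e a) b)
    · exact (Complex.imCLM.analyticAt _).comp (hV t (e a) b)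
  -- Zeros accumulating at `1` would make `f` vanish identically, but `f 0` is a minor of `X`
  -- itself.
  by_contra hcon
  have hcon' : ∃ᶠ t in 𝓝[≠] 1, f t = 0 := fun h => hcon h
  have h0 := hfa.eqOn_zero_of_preconnected_of_frequently_eq_zero isPreconnected_univ
    (Set.mem_univ 1) hcon' (Set.mem_univ 0)
  refine hX e he ?_
  simpa [hf, denom] using h0

open Filter Topology in
theorem tendsto_scattering {n : ℕ} (Z₀ : ℝ) {B : Matrix (Fin n) (Fin n) ℝ} (hB : B.IsSymm) :
    Tendsto (fun t : ℝ => scattering Z₀ (t • B)) (𝓝 1) (𝓝 (scattering Z₀ B)) := by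
  have hc : Continuous fun t : ℝ => (Complex.I * (Z₀ : ℂ)) • (t • B).map Complex.ofReal :=
    (continuous_const_smul _).comp
      ((continuous_id.smul continuous_const).matrix_map Complex.continuous_ofReal)
  have hd : ContinuousAt (fun t : ℝ => (denom Z₀ (t • B))⁻¹) 1 := by
    have hcd : Continuous fun t : ℝ => denom Z₀ (t • B) := continuous_const.add hc
    simp only [Matrix.inv_def, Ring.inverse_eq_inv']
    exact (hcd.matrix_det.continuousAt.inv₀ (det_denom_ne_zero Z₀ (hB.smul 1))).smul
      hcd.matrix_adjugate.continuousAt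
  have h : ContinuousAt (fun t : ℝ => scattering Z₀ (t • B)) 1 :=
    hd.mul (continuous_const.sub hc).continuousAt
  have h1 := h.tendsto
  rwa [one_smul] at h1


/-! ### Generic minors and the graph condition -/

open Matrix MeasureTheory in
/-- Almost all points of a space that maps linearly onto the complex matrices have nonvanishing
maximal minors of `realParts`. -/
theorem ae_minors_ne_zero {E ι : Type*} [Fintype ι] [DecidableEq ι] {n : ℕ}
    [NormedAddCommGroup E] [NormedSpace ℝ E] [MeasurableSpace E] [BorelSpace E]
    [FiniteDimensional ℝ E] (μ : Measure E) [μ.IsAddHaarMeasure]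
    (X : E →ₗ[ℝ] Matrix (Fin n) ι ℂ) (hX : Function.Surjective X) :
    ∀ᵐ x ∂μ, ∀ e : ι ⊕ ι → Fin n, Function.Injective e →
      ((realParts (X x)).submatrix e id).det ≠ 0 := by
  rw [ae_all_iff]
  intro e
  by_cases he : Function.Injective e
  swap
  · exact Filter.Eventually.of_forall fun _ h => absurd h he
  let φ : E →ₗ[ℝ] Matrix (ι ⊕ ι) (ι ⊕ ι) ℝ :=
    { toFun := fun x => (realParts (X x)).submatrix e id
      map_add' := fun x y => by ext a (b | b) <;> simp [realParts]
      map_smul' := fun c x => by ext a (b | b) <;> simp [realParts] }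
  -- A point whose selected minor is the identity matrix.
  obtain ⟨v, hv⟩ := hX (of fun i j =>
    ⟨if i = e (Sum.inl j) then 1 else 0, if i = e (Sum.inr j) then 1 else 0⟩)
  refine (ae_det_linearMap_ne_zero μ φ v ?_).mono fun x hx _ => hx
  ext a (b | b) <;> simp [φ, hv, realParts, he.eq_iff, one_apply]

-- Conjugation by a permutation matrix relabels vertices, so the partial row sums of `Ā` count later
-- neighbours.
open Finset in
theorem GraphCondition.exists_perm {NI : ℕ} {L : ℝ} {G : SimpleGraph (Fin NI)}
    [DecidableRel G.Adj] (hG : GraphCondition L G) : ∃ τ : Equiv.Perm (Fin NI), ∀ a : Fin NI,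
      (a : ℕ) + 1 ≤ NI - 1 → (#{b ∈ Ioi a | G.Adj (τ a) (τ b)} : ℝ) =
        min (2 * L - 1) ((NI : ℝ) - ((a : ℕ) + 1 : ℝ)) := by
  obtain ⟨σ, Abar, hA, hsum⟩ := hG
  refine ⟨σ⁻¹, fun a ha => ?_⟩
  rw [← hsum a ha, card_filter, Nat.cast_sum]
  refine sum_congr rfl fun b _ => ?_
  rw [Matrix.transpose_permMatrix, PEquiv.toMatrix_toPEquiv_mul,
    PEquiv.mul_toMatrix_toPEquiv] at hA
  have := congrFun (congrFun hA (σ⁻¹ a)) (σ⁻¹ b)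
  simp only [SimpleGraph.adjMatrix_apply, Matrix.submatrix_apply, id_eq] at this
  rw [Nat.cast_ite, Nat.cast_one, Nat.cast_zero, this]
  congr 1 <;> simp [Equiv.Perm.inv_def]

open Finset in
theorem graphSet_eq_univ_of_perm {NI : ℕ} {G : SimpleGraph (Fin NI)} [DecidableRel G.Adj]
    (τ : Equiv.Perm (Fin NI))
    (hτ : ∀ a : Fin NI, (a : ℕ) + 1 ≤ NI - 1 →
      NI - (a + 1) ≤ #{b ∈ Ioi a | G.Adj (τ a) (τ b)}) : graphSet G = Set.univ := by
  have key : ∀ a b : Fin NI, a < b → G.Adj (τ a) (τ b) := by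
    intro a b hab
    have h1 : filter (fun b => G.Adj (τ a) (τ b)) (Ioi a) = Ioi a := by
      apply eq_of_subset_of_card_le (filter_subset _ _)
      rw [Fin.card_Ioi]
      have := hτ a (by have := b.2; have : (a : ℕ) < b := hab; omega)
      omega
    exact (mem_filter.1 ((Finset.ext_iff.1 h1 b).2 (mem_Ioi.2 hab))).2
  refine Set.eq_univ_of_forall fun B n m hnm hn => (hn ?_).elim
  obtain ⟨a, rfl⟩ := τ.surjective n
  obtain ⟨b, rfl⟩ := τ.surjective m
  rcases lt_trichotomy a b with h | h | h
  · exact key _ _ h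
  · exact absurd (by rw [h]) hnm
  · exact (key _ _ h).symm

open Matrix Finset Filter Topology in
/-- On a generic matrix `X`, the scattering matrix of `t B` agrees with one of the graph, for `t`
close to `1`. -/
theorem eventually_exists_graphSet {NI : ℕ} {ι : Type*} [Fintype ι] [DecidableEq ι] [Nonempty ι]
    (hι : 2 * Fintype.card ι ≤ NI) (Z₀ : ℝ) (G : SimpleGraph (Fin NI)) [DecidableRel G.Adj]
    (τ : Equiv.Perm (Fin NI))
    (hτ : ∀ a : Fin NI, (a : ℕ) + 1 ≤ NI - 1 →
      #{b ∈ Ioi a | G.Adj (τ a) (τ b)} = min (2 * Fintype.card ι - 1) (NI - (a + 1)))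
    (X : Matrix (Fin NI) ι ℂ)
    (hX : ∀ e : ι ⊕ ι → Fin NI, Function.Injective e → ((realParts X).submatrix e id).det ≠ 0)
    {B : Matrix (Fin NI) (Fin NI) ℝ} (hB : B.IsSymm) :
    ∀ᶠ t : ℝ in 𝓝[≠] 1, ∃ B' : Matrix (Fin NI) (Fin NI) ℝ, B'.IsSymm ∧ B' ∈ graphSet G ∧
      scattering Z₀ B' * X = scattering Z₀ (t • B) * X := by
  filter_upwards [eventually_minors_ne_zero Z₀ hB X hX] with t ht
  set V := realParts ((denom Z₀ (t • B))⁻¹ * X) with hV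
  have hcard : Fintype.card (ι ⊕ ι) = 2 * Fintype.card ι := by rw [Fintype.card_sum]; ring
  obtain ⟨B', hB', hsupp, hmul⟩ := exists_isSymm_supported_mul_eq (κ := ι ⊕ ι)
    (NI - 2 * Fintype.card ι) NI (by rw [hcard]; omega) (V.submatrix τ id)
    ((t • B * V).submatrix τ id)
    (fun e he => ht (fun x => τ (e x)) (τ.injective.comp he))
    (by
      have h1 : (V.submatrix τ id)ᵀ * (t • B * V).submatrix τ id = Vᵀ * (t • B) * V := by
        rw [transpose_submatrix, submatrix_mul_equiv, Matrix.mul_assoc, submatrix_id_id]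
      rw [h1, IsSymm, transpose_mul, transpose_mul, transpose_transpose, hB.smul t,
        Matrix.mul_assoc])
    (fun i j => G.Adj (τ i) (τ j)) (fun i j h => h.symm)
    (by
      intro i
      refine ⟨filter (fun b => G.Adj (τ i) (τ b)) (Ioi i), fun j hj => by simpa using hj, ?_⟩
      rw [hcard]
      -- The graph condition omits the last vertex, which has no later neighbours and needs none.
      by_cases hi : (i : ℕ) + 1 ≤ NI - 1
      · rw [hτ i hi]; omega
      · have hle := card_filter_le (Ioi i) (fun b => G.Adj (τ i) (τ b))
        rw [Fin.card_Ioi] at hle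
        omega)
  refine ⟨B'.submatrix τ.symm τ.symm, hB'.submatrix _, ?_, ?_⟩
  · intro n m hnm hn
    exact hsupp _ _ (fun h => hnm (τ.symm.injective h)) (by simpa using hn)
  · refine scattering_mul_eq Z₀ (hB.smul t) (hB'.submatrix _) X ?_
    have h := congrArg (fun M => M.submatrix τ.symm id) hmul
    simp only [submatrix_submatrix, Equiv.self_comp_symm, Function.id_comp, submatrix_id_id] at h
    rw [← hV, ← h, submatrix_mul _ _ τ.symm τ.symm id τ.symm.bijective, submatrix_submatrix]
    simp

/-! ### Effective channels, the limit `t → 1` and almost all channels -/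

variable {K : ℕ} {N : Fin K → ℕ} {NI NT : ℕ}

theorem effChannel_congr_of_mul_incident (h : Channel K N NI NT) {Θ Θ' : Matrix (Fin NI) (Fin NI) ℂ}
    (hΘ : Θ * h.incident = Θ' * h.incident) : effChannel h Θ = effChannel h Θ' := by
  ext r j
  simp only [effChannel, userEffChannel, Matrix.mul_assoc, hΘ]

/-- The transposed channels from the RIS to the users, side by side. -/
def reflectTranspose (h : Channel K N NI NT) : Matrix (Fin NI) ((k : Fin K) × Fin (N k)) ℂ :=
  Matrix.of fun i r => h.reflect r.1 r.2 i

-- For symmetric `Θ`, `H_{r,k} Θ` is the transpose of `Θ H_{r,k}ᵀ`.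
open Matrix in
theorem effChannel_congr_of_mul_reflectTranspose (h : Channel K N NI NT)
    {Θ Θ' : Matrix (Fin NI) (Fin NI) ℂ} (hs : Θ.IsSymm) (hs' : Θ'.IsSymm)
    (hΘ : Θ * reflectTranspose h = Θ' * reflectTranspose h) :
    effChannel h Θ = effChannel h Θ' := by
  have key : ∀ k, h.reflect k * Θ = h.reflect k * Θ' := by
    intro k
    ext r j
    have := congrFun (congrFun hΘ j) ⟨k, r⟩
    simp only [mul_apply, reflectTranspose, of_apply] at this ⊢
    simpa only [hs.apply, hs'.apply, mul_comm] using this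
  ext r j
  simp only [effChannel, userEffChannel, key]

theorem continuous_effChannel (h : Channel K N NI NT) : Continuous (effChannel h) := by
  refine continuous_matrix fun r j => ?_
  simp only [effChannel, userEffChannel, Matrix.of_apply]
  exact (continuous_const.add ((continuous_const.matrix_mul continuous_id).matrix_mul
    continuous_const)).matrix_elem r.2 j

open Filter Topology in
theorem graphValue_eq_fullValue {d : Fin K → ℕ} {Z₀ : ℝ} {G : SimpleGraph (Fin NI)}
    {F : Matrix (Fin NT) ((k : Fin K) × Fin (d k)) ℂ →
      Matrix ((k : Fin K) × Fin (N k)) (Fin NT) ℂ → EReal}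
    {𝒲 : Set (Matrix (Fin NT) ((k : Fin K) × Fin (d k)) ℂ)}
    (hF : LowerSemicontinuous fun H => ⨆ W ∈ 𝒲, F W H) (h : Channel K N NI NT)
    (hh : ∀ B : Matrix (Fin NI) (Fin NI) ℝ, B.IsSymm → ∀ᶠ t : ℝ in 𝓝[≠] 1,
      ∃ B' : Matrix (Fin NI) (Fin NI) ℝ, B'.IsSymm ∧ B' ∈ graphSet G ∧
        effChannel h (scattering Z₀ B') = effChannel h (scattering Z₀ (t • B))) :
    graphValue Z₀ F 𝒲 G h = fullValue Z₀ F 𝒲 h := by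
  apply le_antisymm
  · refine sSup_le_sSup ?_
    rintro y ⟨W, Θ, B, h1, h2, -, h4, h5⟩
    exact ⟨W, Θ, B, h1, h2, Set.mem_univ _, h4, h5⟩
  · refine sSup_le ?_
    rintro y ⟨W, Θ, B, rfl, hB, -, hW, rfl⟩
    -- The channels whose supremum over `𝒲` is at most `P_G` form a closed set, containing those of
    -- `t B` for `t ≠ 1` near `1`.
    have hclosed := hF.isClosed_preimage (graphValue Z₀ F 𝒲 G h)
    have hB' : B.IsSymm := hB.symm
    have hlim : Tendsto (fun t : ℝ => effChannel h (scattering Z₀ (t • B))) (𝓝[≠] 1)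
        (𝓝 (effChannel h (scattering Z₀ B))) :=
      ((continuous_effChannel h).tendsto _).comp
        ((tendsto_scattering Z₀ hB').mono_left nhdsWithin_le_nhds)
    have hmem := hclosed.mem_of_tendsto hlim <| by
      filter_upwards [hh B hB'] with t ht
      obtain ⟨B', hs, hG, he⟩ := ht
      rw [Set.mem_preimage, Set.mem_Iic]
      exact iSup₂_le fun W hW => le_sSup ⟨W, _, B', rfl, hs.symm, hG, hW, by rw [he]⟩
    exact (le_iSup₂ (f := fun W (_ : W ∈ 𝒲) => F W (effChannel h (scattering Z₀ B))) W hW).trans hmem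

open MeasureTheory in
instance isAddHaarMeasure_volume_channel :
    (volume : Measure (Channel K N NI NT)).IsAddHaarMeasure := by
  have hmat (m n : ℕ) : (volume : Measure (Fin m → Fin n → ℂ)).IsAddHaarMeasure :=
    Measure.pi.isAddHaarMeasure _
  have hstack (n : ℕ) : (volume : Measure ((k : Fin K) → Fin (N k) → Fin n → ℂ)).IsAddHaarMeasure :=
    Measure.pi.isAddHaarMeasure _
  have : MeasurableAdd (((k : Fin K) → Fin (N k) → Fin NI → ℂ) × (Fin NI → Fin NT → ℂ)) :=
    ⟨fun c => (continuous_const.add continuous_id).measurable,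
      fun c => (continuous_id.add continuous_const).measurable⟩
  have := Measure.prod.instIsAddHaarMeasure
    (volume : Measure ((k : Fin K) → Fin (N k) → Fin NI → ℂ))
    (volume : Measure (Fin NI → Fin NT → ℂ))
  exact Measure.prod.instIsAddHaarMeasure _ _

open MeasureTheory in
theorem ae_minors_incident : ∀ᵐ h : Channel K N NI NT, ∀ e : Fin NT ⊕ Fin NT → Fin NI,
    Function.Injective e → ((realParts h.incident).submatrix e id).det ≠ 0 := by
  let X : Channel K N NI NT →ₗ[ℝ] Matrix (Fin NI) (Fin NT) ℂ :=
    { toFun := fun h => h.incident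
      map_add' := fun _ _ => rfl
      map_smul' := fun _ _ => rfl }
  exact ae_minors_ne_zero volume X fun Y => ⟨(0, 0, Y), rfl⟩

open MeasureTheory in
theorem ae_minors_reflectTranspose : ∀ᵐ h : Channel K N NI NT,
    ∀ e : ((k : Fin K) × Fin (N k)) ⊕ ((k : Fin K) × Fin (N k)) → Fin NI,
    Function.Injective e → ((realParts (reflectTranspose h)).submatrix e id).det ≠ 0 := by
  let X : Channel K N NI NT →ₗ[ℝ] Matrix (Fin NI) ((k : Fin K) × Fin (N k)) ℂ :=
    { toFun := reflectTranspose
      map_add' := fun _ _ => rfl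
      map_smul' := fun _ _ => rfl }
  exact ae_minors_ne_zero volume X fun Y => ⟨(0, fun k r i => Y i ⟨k, r⟩, 0), rfl⟩

end BDRIS

open BDRIS in
theorem theorem1 (K : ℕ) (N d : Fin K → ℕ) (NI NT : ℕ) (Z₀ : ℝ) (hZ₀ : 0 < Z₀)
    (G : SimpleGraph (Fin NI)) [DecidableRel G.Adj]
    (hG : BDRIS.GraphCondition (BDRIS.bigL N NI NT) G)
    (F : Matrix (Fin NT) ((k : Fin K) × Fin (d k)) ℂ →
      Matrix ((k : Fin K) × Fin (N k)) (Fin NT) ℂ → EReal)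
    (𝒲 : Set (Matrix (Fin NT) ((k : Fin K) × Fin (d k)) ℂ))
    (hF : LowerSemicontinuous fun H => ⨆ W ∈ 𝒲, F W H) :
    ∀ᵐ h : BDRIS.Channel K N NI NT,
      BDRIS.graphValue Z₀ F 𝒲 G h = BDRIS.fullValue Z₀ F 𝒲 h := by
  obtain ⟨τ, hτ⟩ := hG.exists_perm
  -- If `NI ≤ 2D`, then `2L - 1 = NI - 1` and every pair of vertices is adjacent; for `NI ≤ 1` there
  -- are no pairs.
  by_cases hD : NI ≤ 2 * dof N NT ∨ NI ≤ 1
  · have huniv : graphSet G = Set.univ := by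
      refine graphSet_eq_univ_of_perm τ fun a ha => ?_
      have hD' : (NI : ℝ) ≤ 2 * dof N NT := by exact_mod_cast hD.resolve_right (by omega)
      have h1 := hτ a ha
      have hL : bigL N NI NT = (NI : ℝ) / 2 := min_eq_right (by linarith)
      have ha' := a.2
      rw [hL, min_eq_right (by have : (0 : ℝ) ≤ (a : ℕ) := Nat.cast_nonneg _; linarith)] at h1
      rw [← Nat.cast_le (α := ℝ), h1, Nat.cast_sub (by omega)]
      push_cast
      exact le_rfl
    refine Filter.Eventually.of_forall fun h => ?_
    rw [graphValue, fullValue, huniv]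
  · push Not at hD
    obtain ⟨hD, hNI⟩ := hD
    have hD' : (2 * dof N NT : ℝ) < NI := by exact_mod_cast hD
    have hL : bigL N NI NT = dof N NT := min_eq_left (by linarith)
    rw [hL] at hτ
    -- `D = 0` would force a neighbour count of at most `-1`.
    have hpos : 0 < dof N NT := by
      by_contra h0
      have h0 : dof N NT = 0 := by omega
      have h1 := hτ ⟨0, by omega⟩ (by simp; omega)
      have h2 := min_le_left (2 * ((dof N NT : ℕ) : ℝ) - 1)
        ((NI : ℝ) - (((⟨0, by omega⟩ : Fin NI) : ℕ) + 1 : ℝ))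
      rw [← h1, h0] at h2
      have h3 := (Nat.cast_nonneg _ : (0 : ℝ) ≤ _).trans h2
      norm_num at h3
    have hτ' : ∀ a : Fin NI, (a : ℕ) + 1 ≤ NI - 1 →
        (Finset.filter (fun b => G.Adj (τ a) (τ b)) (Finset.Ioi a)).card =
          min (2 * dof N NT - 1) (NI - (a + 1)) := by
      intro a ha
      rw [← Nat.cast_inj (R := ℝ), hτ a ha, Nat.cast_min, Nat.cast_sub (by omega),
        Nat.cast_sub (by omega)]
      push_cast
      rfl
    rcases le_total (∑ k, N k) NT with hle | hle
    · have hdof : dof N NT = Fintype.card ((k : Fin K) × Fin (N k)) := by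
        simp [dof, hle]
      rw [hdof] at hτ' hD hpos
      have : Nonempty ((k : Fin K) × Fin (N k)) := Fintype.card_pos_iff.1 hpos
      filter_upwards [ae_minors_reflectTranspose] with h hh
      refine graphValue_eq_fullValue hF h fun B hB => ?_
      filter_upwards [eventually_exists_graphSet hD.le Z₀ G τ hτ' _ hh hB] with t ht
      obtain ⟨B', hs, hmem, he⟩ := ht
      exact ⟨B', hs, hmem, effChannel_congr_of_mul_reflectTranspose h (scattering_isSymm Z₀ hs)
        (scattering_isSymm Z₀ (hB.smul t)) he⟩
    · have hdof : dof N NT = Fintype.card (Fin NT) := by simp [dof, hle]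
      rw [hdof] at hτ' hD hpos
      have : Nonempty (Fin NT) := Fintype.card_pos_iff.1 hpos
      filter_upwards [ae_minors_incident] with h hh
      refine graphValue_eq_fullValue hF h fun B hB => ?_
      filter_upwards [eventually_exists_graphSet hD.le Z₀ G τ hτ' _ hh hB] with t ht
      obtain ⟨B', hs, hmem, he⟩ := ht
      exact ⟨B', hs, hmem, effChannel_congr_of_mul_incident h he⟩
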